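/- Let $\mathcal G=(V,\mathcal I,\mathcal E,\partial)$ be a finite graph: finite sets $V$ of vertices, $\mathcal I$ of internal edges and $\mathcal E$ of external edges, where $\partial$ assigns to each $i\in\mathcal I$ an ordered pair $(\partial^-(i),\partial^+(i))$ of (possibly equal) vertices and to each $e\in\mathcal E$ one vertex $\partial(e)$. Let $\mathcal K=\mathbb C^{\mathcal E}\oplus\mathbb C^{\mathcal I}\oplus\mathbb C^{\mathcal I}$, and for $v\in V$ let $\mathcal L_v\subset\mathcal K$ be spanned by the coordinates $e\in\mathcal E$ with $\partial(e)=v$, $i$ in the first copy of $\mathcal I$ with $\partial^-(i)=v$ and $i$ in the second copy with $\partial^+(i)=v$, so that $\mathcal K=\bigoplus_v\mathcal L_v$ and $\dim\mathcal L_v=\deg(v)$ (tadpoles, i.e. loops, are counted twice). Boundary conditions are pairs $(A,B)$ of linear maps of $\mathcal K$ such that $(A,B):\mathcal K\oplus\mathcal K\to\mathcal K$ has maximal rank and $AB^\dagger$ is self-adjoint. For real $k>0$ and $\underline a\in\mathbb R^{\mathcal I}$ the scattering matrix $S(k;A,B,\underline a)$, of size $|\mathcal E|\times|\mathcal E|$,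 is defined by the requirement that for each $e'\in\mathcal E$ there are $\alpha,\beta\in\mathbb C^{\mathcal I}$ such that the functions $\psi_e(x)=\delta_{e,e'}\mathrm e^{-\mathrm ikx}+[S]_{e,e'}\mathrm e^{\mathrm ikx}$ ($e\in\mathcal E$) and $\psi_i(x)=\alpha_i\mathrm e^{\mathrm ikx}+\beta_i\mathrm e^{-\mathrm ikx}$ ($i\in\mathcal I$) satisfy $A\underline\psi+B\underline\psi'=0$, where $\underline\psi=(\{\psi_e(0)\},\{\psi_i(0)\},\{\psi_i(a_i)\})$ and $\underline\psi'=(\{\psi_e'(0)\},\{\psi_i'(0)\},\{-\psi_i'(a_i)\})$. It is $\frac{2\pi}k$-periodic in each $a_i$, and its Fourier coefficients are, for $\underline n\in\mathbb Z^{\mathcal I}$, $$\widehat S_{\underline n}(k;A,B)=\Big(\frac{k}{2\pi}\Big)^{|\mathcal I|}\int_{[0,2\pi/k]^{\mathcal I}}S(k;A,B,\underline a)\,\mathrm e^{-\mathrm ik\langle\underline n,\underline a\rangle}\,d\underline a .$$ A walk from $e'\in\mathcal E$ to $e\in\mathcal E$ is a sequence $\{e',i_1,\dots,i_N,e\}$,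 $N\ge0$, $i_1,\dots,i_N\in\mathcal I$, for which there are vertices $v_0=\partial(e'),v_1,\dots,v_N=\partial(e)$ such that, for $0\le k<N$, $v_k$ and $v_{k+1}$ are end points of $i_{k+1}$, and $v_k=v_{k+1}$ if and only if $i_{k+1}$ is a tadpole. Its score is $\underline n=(n_i)_{i\in\mathcal I}$, where $n_i$ is the number of $j\in\{1,\dots,N\}$ with $i_j=i$. Let $\mathcal W_{e,e'}(\underline n)$ be the set of walks from $e'$ to $e$ with score $\underline n$ (empty if some $n_i<0$). Fix a real $k_0\ne0$. For a unitary $U=(U_v)_{v\in V}\in\prod_{v\in V}\mathsf U(\mathcal L_v)$ let $\mathcal M(U)=\bigoplus_{v}\mathcal M_v(U_v)$, where $\mathcal M_v(U_v)=\{(\chi,\chi')\in\mathcal L_v\oplus\mathcal L_v:\ -\tfrac12(U_v-1)\chi+\tfrac1{2\mathrm ik_0}(U_v+1)\chi'=0\}$; the boundary conditions $(A,B)$ with $\ker(A,B)=\mathcal M(U)$ for some $U$ are the local ones. A property holds for Haar almost all local boundary conditions if, for almost every $U$ with respect to the product of the normalized Haar measures on the groups $\mathsf U(\mathcal L_v)$,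 it holds for all boundary conditions $(A,B)$ with $\ker(A,B)=\mathcal M(U)$. Theorem. For Haar almost all local boundary conditions $(A,B)$ on $\mathcal G$ the following holds for all $e,e'\in\mathcal E$ and all $\underline n\in\mathbb Z^{\mathcal I}$: the matrix element $[\widehat S_{\underline n}(k;A,B)]_{e,e'}$ vanishes for all $k>0$ if and only if $\mathcal W_{e,e'}(\underline n)=\emptyset$. -/

import Mathlib

namespace QuantumGraph

/-- A graph with vertex set `V`, internal edges `I` and external edges `E`: every internal edge has
an ordered pair of (possibly equal) end points, every external edge has one end point. -/
structure OpenGraph (V I E : Type*) where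
  /-- the initial vertex of an internal edge -/
  ini : I → V
  /-- the terminal vertex of an internal edge -/
  ter : I → V
  /-- the vertex of an external edge -/
  ext : E → V

/-- The index set of the boundary values: `ψ_e(0)`, then `ψ_i(0)`, then `ψ_i(a_i)`. -/
abbrev Ends (I E : Type*) : Type _ := E ⊕ I ⊕ I

/-! ### Walks -/

namespace OpenGraph

variable {V I E : Type*}

/-- The vertex `v` is an end point of the internal edge `i`. -/
def Incident (G : OpenGraph V I E) (v : V) (i : I) : Prop := v = G.ini i ∨ v = G.ter i

/-- The internal edge `i` is a tadpole (a loop). -/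
def IsTadpole (G : OpenGraph V I E) (i : I) : Prop := G.ini i = G.ter i

/-- `{e', i₁, …, i_N, e}` is a walk from `e'` to `e`, where `l = [i₁, …, i_N]`: there are vertices
`v₀ = ∂(e'), v₁, …, v_N = ∂(e)` such that `v_k` and `v_{k+1}` are end points of `i_{k+1}`,
and `v_k = v_{k+1}` if and only if `i_{k+1}` is a tadpole. For `l = []` this is the trivial
walk, which exists if and only if `∂(e') = ∂(e)`. -/
def IsWalk (G : OpenGraph V I E) (e' e : E) (l : List I) : Prop :=
  ∃ v : Fin (l.length + 1) → V, v 0 = G.ext e' ∧ v (Fin.last l.length) = G.ext e ∧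
    ∀ k : Fin l.length, G.Incident (v k.castSucc) (l.get k) ∧ G.Incident (v k.succ) (l.get k) ∧
      (v k.castSucc = v k.succ ↔ G.IsTadpole (l.get k))

/-- The set of walks from `e'` to `e` with score `n`: each internal edge `i` is traversed exactly
`n i` times. (Empty if some `n i` is negative.) -/
def walksWithScore [DecidableEq I] (G : OpenGraph V I E) (e e' : E) (n : I → ℤ) : Set (List I) :=
  {l | G.IsWalk e' e l ∧ ∀ i, (l.count i : ℤ) = n i}

/-- The vertex at which an end of an edge is located. -/
def vertexOf (G : OpenGraph V I E) : Ends I E → V := Sum.elim G.ext (Sum.elim G.ini G.ter)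

/-- The ends of edges located at `v`; there are `deg v` of them, tadpoles counting twice. -/
abbrev Star (G : OpenGraph V I E) (v : V) : Type _ := {h : Ends I E // G.vertexOf h = v}

end OpenGraph

/-! ### Boundary conditions `A ψ + B ψ' = 0` -/

section BoundaryConditions

variable {ι : Type*} [Fintype ι]

/-- The boundary conditions `(A, B)` define a self-adjoint Laplace operator: the matrix `(A, B)`
has maximal rank and `A B†` is Hermitian. -/
def IsSelfAdjointBC (A B : Matrix ι ι ℂ) : Prop :=
  (Matrix.fromCols A B).rank = Fintype.card ι ∧ (A * B.conjTranspose).IsHermitian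

/-- The space `ker (A, B)` of the pairs `(χ, χ')` with `A χ + B χ' = 0`. -/
noncomputable def bcSpace (A B : Matrix ι ι ℂ) : Submodule ℂ ((ι → ℂ) × (ι → ℂ)) :=
  LinearMap.ker (A.mulVecLin.coprod B.mulVecLin)

/-- The maximal isotropic subspace with parameter `U`, i.e. `ker (A, B)` for the matrices
`A = -(U - 1) / 2` and `B = (U + 1) / (2 i k₀)`, for which
`-(A + i k₀ B)⁻¹ (A - i k₀ B) = U`. -/
noncomputable def unitarySpace [DecidableEq ι] (k₀ : ℝ) (U : Matrix ι ι ℂ) :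
    Submodule ℂ ((ι → ℂ) × (ι → ℂ)) :=
  bcSpace (-(1 / 2 : ℂ) • (U - 1)) ((1 / (2 * Complex.I * (k₀ : ℂ))) • (U + 1))

end BoundaryConditions

/-- The orthogonal sum over all vertices `v` of subspaces `M v` of the doubled spaces of boundary
values at `v`: a pair of vectors belongs to the sum if and only if each of its components does. -/
noncomputable def OpenGraph.vertexSum {V I E : Type*} (G : OpenGraph V I E)
    (M : ∀ v, Submodule ℂ ((G.Star v → ℂ) × (G.Star v → ℂ))) :
    Submodule ℂ ((Ends I E → ℂ) × (Ends I E → ℂ)) :=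
  ⨅ v, (M v).comap (LinearMap.prodMap
    (LinearMap.funLeft ℂ ℂ (Subtype.val : G.Star v → Ends I E))
    (LinearMap.funLeft ℂ ℂ (Subtype.val : G.Star v → Ends I E)))

/-! ### Haar measure -/

section Haar

variable {ι : Type*} [Fintype ι] [DecidableEq ι]

/-- The unitary group carries its Borel σ-algebra. -/
noncomputable instance unitaryGroupMeasurableSpace : MeasurableSpace (Matrix.unitaryGroup ι ℂ) := borel _

/-- The σ-algebra on the unitary group is the Borel σ-algebra. -/
instance unitaryGroupBorelSpace : BorelSpace (Matrix.unitaryGroup ι ℂ) := ⟨rfl⟩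

/-- The unitary group is compact. -/
instance unitaryGroupCompactSpace : CompactSpace (Matrix.unitaryGroup ι ℂ) := by
  have hK : IsCompact (Set.univ.pi fun _ : ι => Set.univ.pi fun _ : ι =>
      Metric.closedBall (0 : ℂ) 1) :=
    isCompact_univ_pi fun _ => isCompact_univ_pi fun _ => isCompact_closedBall _ _
  have hcl : IsClosed {U : Matrix ι ι ℂ | star U * U = 1 ∧ U * star U = 1} :=
    (isClosed_eq (by fun_prop) continuous_const).inter (isClosed_eq (by fun_prop) continuous_const)
  exact isCompact_iff_compactSpace.mp
    (IsCompact.of_isClosed_subset hK (t := {U | star U * U = 1 ∧ U * star U = 1}) hcl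
      fun U hU i _ j _ => by
        simpa using entry_norm_bound_of_unitary (U := U) (Unitary.mem_iff.mpr hU) i j)

variable (ι) in
/-- The normalized Haar measure on the unitary group. -/
noncomputable def haarUnitary : MeasureTheory.Measure (Matrix.unitaryGroup ι ℂ) :=
  MeasureTheory.Measure.haarMeasure ⊤

end Haar

/-- The property `P` of boundary conditions holds for Haar almost all local boundary conditions
on `G`: for almost all `(U v)` in the product over the vertices `v` of the unitary groups
`U(deg v)`, it holds for all self-adjoint boundary conditions `(A, B)` whose space `ker (A, B)` is
the orthogonal sum of the maximal isotropic subspaces with parameters `U v` (at reference energy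
`k₀ ^ 2`). -/
def OpenGraph.HaarAlmostAllLocalBC {V I E : Type*} [Fintype V] [Fintype I] [Fintype E]
    [DecidableEq V] [DecidableEq I] [DecidableEq E] (G : OpenGraph V I E) (k₀ : ℝ)
    (P : Matrix (Ends I E) (Ends I E) ℂ → Matrix (Ends I E) (Ends I E) ℂ → Prop) : Prop :=
  ∀ᵐ U ∂(MeasureTheory.Measure.pi fun v => haarUnitary (G.Star v)),
    ∀ A B : Matrix (Ends I E) (Ends I E) ℂ, IsSelfAdjointBC A B →
      bcSpace A B = G.vertexSum (fun v => unitarySpace k₀ (U v : Matrix (G.Star v) (G.Star v) ℂ)) →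
      P A B

/-! ### The scattering matrix and its Fourier coefficients -/

section Scattering

variable {I E : Type*} [Fintype I] [Fintype E] [DecidableEq E]

/-- The wave on the external edge `e`, for an incoming plane wave on the external edge `e'`:
`δ_{e e'} exp(-ikx) + s exp(ikx)`. -/
noncomputable def extWave (k : ℝ) (e' e : E) (s : ℂ) (x : ℝ) : ℂ :=
  (if e = e' then Complex.exp (-(Complex.I * k * x)) else 0) + s * Complex.exp (Complex.I * k * x)

/-- The wave `α exp(ikx) + β exp(-ikx)` on an internal edge. -/
noncomputable def intWave (k : ℝ) (α β : ℂ) (x : ℝ) : ℂ :=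
  α * Complex.exp (Complex.I * k * x) + β * Complex.exp (-(Complex.I * k * x))

/-- The functions `extWave k e' e (s e)` on the external edges `e` and
`intWave k (α i) (β i)` on the internal edges `i` (of lengths `a i`) satisfy the boundary conditions
`A ψ + B ψ' = 0`, where the vector `ψ` consists of `ψ_e(0)`, `ψ_i(0)`, `ψ_i(a_i)` and the
vector `ψ'` of `ψ_e'(0)`, `ψ_i'(0)`, `-ψ_i'(a_i)`. They solve `-ψ'' = k² ψ` on every edge. -/
def IsScatteringSolution (A B : Matrix (Ends I E) (Ends I E) ℂ) (k : ℝ) (a : I → ℝ) (e' : E)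
    (s : E → ℂ) (α β : I → ℂ) : Prop :=
  A.mulVec (Sum.elim (fun e => extWave k e' e (s e) 0)
      (Sum.elim (fun i => intWave k (α i) (β i) 0) (fun i => intWave k (α i) (β i) (a i)))) +
    B.mulVec (Sum.elim (fun e => deriv (extWave k e' e (s e)) 0)
      (Sum.elim (fun i => deriv (intWave k (α i) (β i)) 0)
        (fun i => -deriv (intWave k (α i) (β i)) (a i)))) = 0

open Classical in
/-- The scattering matrix at energy `k²`: its column `e'` is the vector `s` of outgoing amplitudes
of a solution with incoming plane wave on `e'`. (For self-adjoint boundary conditions and real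
`k ≠ 0` such a solution exists and its vector `s` is unique; otherwise the value is arbitrary.) -/
noncomputable def scatteringMatrix (A B : Matrix (Ends I E) (Ends I E) ℂ) (k : ℝ) (a : I → ℝ) :
    Matrix E E ℂ := fun e e' =>
  if h : ∃ s : E → ℂ, ∃ α β : I → ℂ, IsScatteringSolution A B k a e' s α β then h.choose e else 0

/-- The Fourier coefficient with index `n` of the scattering matrix, as a function of the lengths
`a`, which is `2π/k`-periodic in each length. -/
noncomputable def fourierCoeff (A B : Matrix (Ends I E) (Ends I E) ℂ) (k : ℝ) (n : I → ℤ) :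
    Matrix E E ℂ := fun e e' =>
  ((k / (2 * Real.pi) : ℝ) : ℂ) ^ Fintype.card I *
    ∫ a in Set.Icc (0 : I → ℝ) (fun _ => 2 * Real.pi / k),
      scatteringMatrix A B k a e e' * Complex.exp (-(Complex.I * k * ∑ i, (n i : ℂ) * (a i : ℂ)))

end Scattering

end QuantumGraph

namespace QuantumGraph

/-! ### Zero sets of entire functions on unitary groups -/

section NullSets

open NormedSpace MeasureTheory

variable {𝔸 : Type*} [NormedRing 𝔸] [NormedAlgebra ℂ 𝔸] [CompleteSpace 𝔸]

/-! Split the boundary values at the ends of edges into incoming and outgoing amplitudes. At energy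
`k ^ 2` local boundary conditions say that outgoing = `S` · incoming, with `S` unitary and block
diagonal over the vertices. An internal edge carries an outgoing amplitude to its other end and
multiplies it by `z i = exp (i k a i)`. Scattering solutions are thus the solutions of `u = S
(incoming + propagate z u)`.

Iterating this equation from `0` gives the partial sums of a series whose term of degree `m` in `z`
is `walkPoly S e' m`, a sum over walks with `m` internal edges. The operator `id - S ∘ propagate z`
may be singular, but conservation of energy still makes the external amplitudes converge
(`tendsto_outgoing`) and bounds their Cesàro means by `1`, uniformly in the lengths. Dominated
convergence then identifies the Fourier coefficient with index `d` as the coefficient of `z ^ d` in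
the walk polynomial of degree `|d|` (`fourierCoeff_eq_coeff`).

Without walks of score `d` this coefficient is zero for every `k`. With such a walk it is a
polynomial in the entries of `S` that is positive at the all-ones blocks, hence not identically
zero. At `k = |k₀|` the matrix `S` is `U` or its adjoint, and the zero set of a nonzero entire
function on a product of unitary groups is Haar null (`ae_ne_zero_of_differentiable`). Countably
many walks give countably many null sets. -/

theorem differentiable_exp_complex : Differentiable ℂ (exp : 𝔸 → 𝔸) :=
  fun x => (exp_analytic (𝕂 := ℂ) x).differentiableAt

theorem exp_I_smul_add (X : 𝔸) (s t : ℝ) :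
    exp (Complex.I • (((s + t : ℝ) : ℂ) • X)) =
      exp (Complex.I • ((s : ℂ) • X)) * exp (Complex.I • ((t : ℂ) • X)) := by
  let +nondep : NormedAlgebra ℚ 𝔸 := .restrictScalars ℚ ℂ 𝔸
  rw [← exp_add_of_commute]
  · rw [← smul_add, ← add_smul]; push_cast; rfl
  · exact (((Commute.refl X).smul_left _).smul_right _).smul_left _ |>.smul_right _

/-- The real zeros of an entire function that does not vanish identically on the real line form a
null set. -/
theorem volume_real_zeros_eq_zero {φ : ℂ → ℂ} (hφ : Differentiable ℂ φ)
    (h : ¬ ∀ t : ℝ, φ t = 0) : volume {t : ℝ | φ t = 0} = 0 := by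
  push Not at h
  obtain ⟨t₀, ht₀⟩ := h
  have han : AnalyticOnNhd ℝ (fun t : ℝ => φ t) Set.univ := fun t _ =>
    ((hφ.analyticAt (t : ℂ)).restrictScalars (𝕜 := ℝ)).fun_comp (Complex.ofRealCLM.analyticAt t)
  have h1 := han.preimage_zero_mem_codiscrete (x := t₀) ht₀
  have h2 := ae_restrict_le_codiscreteWithin (μ := (volume : Measure ℝ)) MeasurableSet.univ h1
  rw [Measure.restrict_univ, mem_ae_iff] at h2
  convert h2 using 2
  ext t; simp

/-- An entire function that vanishes on the real line vanishes identically. -/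
theorem eq_zero_of_forall_real {φ : ℂ → ℂ} (hφ : Differentiable ℂ φ)
    (h : ∀ t : ℝ, φ t = 0) (z : ℂ) : φ z = 0 := by
  have han : AnalyticOnNhd ℂ φ Set.univ := fun t _ => hφ.analyticAt t
  have hev : ∃ᶠ w in nhdsWithin (0 : ℂ) {0}ᶜ, φ w = 0 := by
    have ht : Filter.Tendsto (fun t : ℝ => (t : ℂ)) (nhdsWithin 0 {0}ᶜ) (nhdsWithin 0 {0}ᶜ) := by
      refine tendsto_nhdsWithin_iff.2 ⟨?_, ?_⟩
      · have := Complex.continuous_ofReal.tendsto 0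
        simp only [Complex.ofReal_zero] at this
        exact this.mono_left nhdsWithin_le_nhds
      · filter_upwards [self_mem_nhdsWithin] with t ht
        simpa using ht
    exact ht.frequently (Filter.Eventually.frequently (Filter.Eventually.of_forall h))
  exact han.eqOn_zero_of_preconnected_of_frequently_eq_zero isPreconnected_univ trivial hev trivial

theorem differentiable_comp_exp_mul {f : 𝔸 → ℂ} (hf : Differentiable ℂ f) (X Y a : 𝔸) :
    Differentiable ℂ fun z : ℂ => f (exp (Complex.I • (X + z • Y)) * a) := by
  refine hf.comp (Differentiable.mul_const (differentiable_exp_complex.comp ?_) a)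
  fun_prop

variable [StarRing 𝔸] [StarModule ℂ 𝔸]

/-- An entire function that vanishes on a left translate of the unitary group (more precisely, of
the exponentials of skew-adjoint elements) by a unit vanishes identically. -/
theorem eq_zero_of_forall_exp_selfAdjoint {f : 𝔸 → ℂ} (hf : Differentiable ℂ f) {a b : 𝔸}
    (hab : b * a = 1) (h : ∀ H ∈ selfAdjoint 𝔸, f (exp (Complex.I • H) * a) = 0) (Y : 𝔸) :
    f Y = 0 := by
  have hexp : ∀ X : 𝔸, f (exp X * a) = 0 := by
    intro X
    -- Weyl's unitary trick: with `Z = H + i K`, the function `t ↦ f (exp (i (H + t K)) * a)`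
    -- vanishes for real `t`, hence also at `t = i`.
    set Z : 𝔸 := (-Complex.I) • X
    have hZ : X = Complex.I • ((realPart Z : 𝔸) + Complex.I • (imaginaryPart Z : 𝔸)) := by
      rw [realPart_add_I_smul_imaginaryPart, smul_smul]; simp
    rw [hZ]
    refine eq_zero_of_forall_real
      (differentiable_comp_exp_mul hf (realPart Z : 𝔸) (imaginaryPart Z : 𝔸) a) (fun t => ?_)
      Complex.I
    refine h _ (add_mem (realPart Z).2 ?_)
    have := (t • imaginaryPart Z).2
    simpa using this
  -- `exp` is a local homeomorphism at `0`, so its values fill a neighbourhood of `1`.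
  have hnhds : ∀ᶠ X in nhds (1 : 𝔸), f (X * a) = 0 := by
    have h1 : HasStrictFDerivAt (exp : 𝔸 → 𝔸)
        ((ContinuousLinearEquiv.refl ℂ 𝔸 : 𝔸 ≃L[ℂ] 𝔸) : 𝔸 →L[ℂ] 𝔸) 0 :=
      hasStrictFDerivAt_exp_zero (𝕂 := ℂ)
    have h2 := h1.map_nhds_eq_of_equiv
    let +nondep : NormedAlgebra ℚ 𝔸 := .restrictScalars ℚ ℂ 𝔸
    rw [exp_zero] at h2
    rw [← h2, Filter.eventually_map]
    exact Filter.Eventually.of_forall hexp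
  -- The complex line from `1` to `Y * b`; at `z = 1` the argument of `f` is `Y * b * a = Y`.
  set φ : ℂ → ℂ := fun z => f ((1 + z • (Y * b - 1)) * a)
  have hφ : Differentiable ℂ φ := by
    refine hf.comp (Differentiable.mul_const ?_ a)
    fun_prop
  have h0 : φ =ᶠ[nhds 0] 0 := by
    have hc : Filter.Tendsto (fun z : ℂ => (1 : 𝔸) + z • (Y * b - 1)) (nhds 0) (nhds 1) := by
      have : Continuous fun z : ℂ => (1 : 𝔸) + z • (Y * b - 1) := by fun_prop
      simpa using this.tendsto 0
    exact hc.eventually hnhds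
  have han : AnalyticOnNhd ℂ φ Set.univ := fun t _ => hφ.analyticAt t
  have := han.eqOn_zero_of_preconnected_of_eventuallyEq_zero isPreconnected_univ trivial h0
    (Set.mem_univ 1)
  simpa [φ, mul_assoc, hab] using this

/-- The zero set of an entire function that does not vanish identically is a null set for every
left invariant measure on the unitary group. -/
theorem ae_ne_zero_of_differentiable [ContinuousStar 𝔸] [SecondCountableTopology 𝔸] {Γ : Type*} [Group Γ]
    [TopologicalSpace Γ] [MeasurableSpace Γ] [BorelSpace Γ] [MeasurableMul Γ]
    (μ : Measure Γ) [SFinite μ] [μ.IsMulLeftInvariant] (ρ : Γ →* 𝔸) (hρ : Continuous ρ)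
    (hsurj : ∀ u ∈ unitary 𝔸, ∃ g, ρ g = u) {f : 𝔸 → ℂ} (hf : Differentiable ℂ f)
    {M : 𝔸} (hM : f M ≠ 0) : ∀ᵐ g ∂μ, f (ρ g) ≠ 0 := by
  -- The zeros at which `f` does not vanish along the whole orbit of the one-parameter group
  -- generated by `H`.
  set N : selfAdjoint 𝔸 → Set Γ := fun H =>
    {g | f (ρ g) = 0 ∧ ¬ ∀ s : ℝ, f (exp (Complex.I • ((s : ℂ) • (H : 𝔸))) * ρ g) = 0}
  have hN : ∀ H, μ (N H) = 0 := by
    intro H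
    set F : ℝ × Γ → ℂ := fun p => f (exp (Complex.I • ((p.1 : ℂ) • (H : 𝔸))) * ρ p.2)
    have hexpc : Continuous (exp : 𝔸 → 𝔸) := differentiable_exp_complex.continuous
    have hF : Continuous F := by
      refine hf.continuous.comp (Continuous.mul (hexpc.comp ?_) (hρ.comp continuous_snd))
      fun_prop
    set W : Set (ℝ × Γ) := {p | F p = 0 ∧ ¬ ∀ s : ℝ, F (s, p.2) = 0}
    have hW : MeasurableSet W := by
      refine (isClosed_eq hF continuous_const).measurableSet.inter ?_
      -- The quantifier over `s` is uncountable; measurability comes from closedness.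
      refine MeasurableSet.compl (IsClosed.measurableSet ?_)
      have : {p : ℝ × Γ | ∀ s : ℝ, F (s, p.2) = 0} = ⋂ s : ℝ, {p | F (s, p.2) = 0} := by
        ext; simp
      change IsClosed {p : ℝ × Γ | ∀ s : ℝ, F (s, p.2) = 0}
      rw [this]
      exact isClosed_iInter fun s => isClosed_eq (hF.comp (by fun_prop)) continuous_const
    have hW0 : (volume.prod μ) W = 0 := by
      rw [Measure.prod_apply_symm hW]
      refine lintegral_eq_zero_of_ae_eq_zero (Filter.Eventually.of_forall fun g => ?_)
      by_cases hg : ∀ s : ℝ, F (s, g) = 0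
      · have : (fun t : ℝ => (t, g)) ⁻¹' W = ∅ := by
          ext t; simp [W, hg]
        simp [this]
      · refine measure_mono_null (fun t ht => ht.1) ?_
        have h1 := differentiable_comp_exp_mul hf 0 (H : 𝔸) (ρ g)
        simp only [zero_add] at h1
        exact volume_real_zeros_eq_zero h1 hg
    rw [Measure.measure_prod_null hW] at hW0
    -- Slices of `W` at fixed `g` are null, as real zeros of a nonzero entire function. By Fubini
    -- some slice at fixed `t` is null too, and it is a left translate of `N H`.
    obtain ⟨t, ht⟩ := hW0.exists
    have hu : exp (Complex.I • ((t : ℂ) • (H : 𝔸))) ∈ unitary 𝔸 := by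
      have := (selfAdjoint.expUnitary (t • H)).2
      simpa using this
    obtain ⟨γ, hγ⟩ := hsurj _ hu
    have hpre : Prod.mk t ⁻¹' W = (fun g => γ * g) ⁻¹' N H := by
      ext g
      simp only [W, N, F, Set.mem_preimage, Set.mem_ofPred_eq, map_mul, hγ]
      refine and_congr Iff.rfl (not_congr ?_)
      simp only [← mul_assoc, ← exp_I_smul_add]
      exact ⟨fun h s => h (s + t), fun h s => by simpa using h (s - t)⟩
    change μ (Prod.mk t ⁻¹' W) = 0 at ht
    rw [hpre, measure_preimage_mul] at ht
    exact ht
  have hae : ∀ᵐ g ∂μ, ∀ n, g ∉ N (TopologicalSpace.denseSeq (selfAdjoint 𝔸) n) :=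
    ae_all_iff.2 fun n => measure_eq_zero_iff_ae_notMem.1 (hN _)
  filter_upwards [hae] with g hg h0
  have hcl : IsClosed {H : selfAdjoint 𝔸 | f (exp (Complex.I • (H : 𝔸)) * ρ g) = 0} := by
    have hexpc : Continuous (exp : 𝔸 → 𝔸) := differentiable_exp_complex.continuous
    refine isClosed_eq (hf.continuous.comp (Continuous.mul (hexpc.comp ?_) continuous_const))
      continuous_const
    fun_prop
  -- Off the null sets a zero at `g` spreads along the orbits of a dense sequence of `H`, and by
  -- continuity to all `H`.
  have hall : ∀ H : selfAdjoint 𝔸, f (exp (Complex.I • (H : 𝔸)) * ρ g) = 0 := by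
    intro H
    refine hcl.closure_subset_iff.2 ?_ (TopologicalSpace.denseRange_denseSeq (selfAdjoint 𝔸) H)
    rintro _ ⟨n, rfl⟩
    have := hg n
    simp only [N, Set.mem_ofPred_eq, not_and, not_not] at this
    simpa using this h0 1
  refine hM (eq_zero_of_forall_exp_selfAdjoint hf (a := ρ g) (b := ρ g⁻¹) ?_
    (fun H hH => hall ⟨H, hH⟩) M)
  rw [← map_mul, inv_mul_cancel, map_one]

end NullSets

/-! ### Unitary matrices and energies -/

section Energy

open Matrix

variable {ι : Type*} [Fintype ι]

/-- The squared Euclidean norm of a vector of amplitudes. -/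
noncomputable def energy (u : ι → ℂ) : ℝ := ∑ x, ‖u x‖ ^ 2

theorem energy_nonneg (u : ι → ℂ) : 0 ≤ energy u :=
  Finset.sum_nonneg fun _ _ => by positivity

theorem ofReal_energy (u : ι → ℂ) : (energy u : ℂ) = star u ⬝ᵥ u := by
  simp [energy, dotProduct, Complex.conj_mul']

theorem energy_eq_zero {u : ι → ℂ} (h : energy u = 0) : u = 0 := by
  rw [energy, Finset.sum_eq_zero_iff_of_nonneg fun _ _ => by positivity] at h
  ext x
  simpa using h x (Finset.mem_univ x)

theorem energy_smul (c : ℂ) (u : ι → ℂ) : energy (c • u) = ‖c‖ ^ 2 * energy u := by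
  simp [energy, mul_pow, Finset.mul_sum]

variable [DecidableEq ι]

theorem energy_mulVec {S : Matrix ι ι ℂ} (hS : S ∈ unitaryGroup ι ℂ) (u : ι → ℂ) :
    energy (S *ᵥ u) = energy u := by
  have h : ((energy (S *ᵥ u) : ℝ) : ℂ) = energy u := by
    rw [ofReal_energy, ofReal_energy, star_mulVec, ← dotProduct_mulVec, mulVec_mulVec,
      ← star_eq_conjTranspose, mem_unitaryGroup_iff'.1 hS, one_mulVec]
  exact_mod_cast h

theorem transpose_mem_unitaryGroup {S : Matrix ι ι ℂ} (hS : S ∈ unitaryGroup ι ℂ) :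
    Sᵀ ∈ unitaryGroup ι ℂ := by
  rw [mem_unitaryGroup_iff, star_eq_conjTranspose]
  have h := mem_unitaryGroup_iff'.1 hS
  rw [star_eq_conjTranspose] at h
  have h2 := congrArg transpose h
  rwa [transpose_mul, transpose_one] at h2

/-- The Cayley-type transformation that relates the unitary parameter of a boundary condition to
its scattering matrix at another energy. -/
theorem exists_unitary_scattering {U : Matrix ι ι ℂ} (hU : U ∈ unitaryGroup ι ℂ) {κ : ℝ}
    (hκ : κ ≠ 0) : ∃ S ∈ unitaryGroup ι ℂ, ∀ a b : ι → ℂ,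
      U *ᵥ ((1 + κ : ℂ) • a + (1 - κ : ℂ) • b) = (1 - κ : ℂ) • a + (1 + κ : ℂ) • b ↔
        b = S *ᵥ a := by
  -- Collecting terms, the relation reads `N b = K a`, so that `S = N⁻¹ K`.
  set N : Matrix ι ι ℂ := (1 + κ : ℂ) • 1 - (1 - κ : ℂ) • U with hN
  set K : Matrix ι ι ℂ := (1 + κ : ℂ) • U - (1 - κ : ℂ) • 1 with hK
  -- A kernel vector of `N` would give `(1 + κ)² = (1 - κ)²`, since `U` preserves energy; this
  -- forces `κ = 0`.
  have hdet : IsUnit N.det := by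
    rw [isUnit_iff_ne_zero]
    intro h0
    obtain ⟨b, hb, hNb⟩ := exists_mulVec_eq_zero_iff.2 h0
    apply hb
    have h1 : (1 + κ : ℂ) • b = (1 - κ : ℂ) • (U *ᵥ b) := by
      rw [hN, sub_mulVec, smul_mulVec, smul_mulVec, one_mulVec, sub_eq_zero] at hNb
      exact hNb
    have h2 := congrArg energy h1
    rw [energy_smul, energy_smul, energy_mulVec hU] at h2
    have e1 : ‖(1 + κ : ℂ)‖ ^ 2 = (1 + κ) ^ 2 := by
      rw [show (1 + κ : ℂ) = ((1 + κ : ℝ) : ℂ) by push_cast; rfl, Complex.norm_real]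
      simp
    have e2 : ‖(1 - κ : ℂ)‖ ^ 2 = (1 - κ) ^ 2 := by
      rw [show (1 - κ : ℂ) = ((1 - κ : ℝ) : ℂ) by push_cast; rfl, Complex.norm_real]
      simp
    rw [e1, e2] at h2
    have h3 : κ * energy b = 0 := by linarith
    exact energy_eq_zero ((mul_eq_zero.1 h3).resolve_left hκ)
  have hU' : U * star U = 1 := mem_unitaryGroup_iff.1 hU
  have hKN : K * star K = N * star N := by
    have s1 : star (1 + κ : ℂ) = 1 + κ := by simp
    have s2 : star (1 - κ : ℂ) = 1 - κ := by simp
    simp only [hN, hK, star_sub, star_smul, star_one, s1, s2, sub_mul, mul_sub, smul_mul_assoc,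
      mul_smul_comm, hU', mul_one, one_mul]
    module
  refine ⟨N⁻¹ * K, ?_, fun a b => ?_⟩
  · rw [mem_unitaryGroup_iff, star_mul, mul_assoc, ← mul_assoc K, hKN, mul_assoc N,
      ← mul_assoc N⁻¹, nonsing_inv_mul _ hdet, one_mul, ← star_mul, nonsing_inv_mul _ hdet,
      star_one]
  · have h1 : U *ᵥ ((1 + κ : ℂ) • a + (1 - κ : ℂ) • b) = (1 - κ : ℂ) • a + (1 + κ : ℂ) • b ↔
        N *ᵥ b = K *ᵥ a := by
      rw [hN, hK, sub_mulVec, sub_mulVec, mulVec_add]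
      simp only [smul_mulVec, one_mulVec, mulVec_smul]
      rw [← sub_eq_zero, eq_comm (a := (1 + κ : ℂ) • b - _),
        ← sub_eq_zero (a := (1 + κ : ℂ) • U *ᵥ a - _)]
      refine Eq.congr ?_ rfl
      abel
    rw [h1]
    constructor
    · intro h
      rw [← mulVec_mulVec, ← h, mulVec_mulVec, nonsing_inv_mul _ hdet, one_mulVec]
    · rintro rfl
      rw [mulVec_mulVec, ← mul_assoc, mul_nonsing_inv _ hdet, one_mul]

/-- In terms of the incoming amplitudes `a` and the outgoing amplitudes `b` at energy `k ^ 2`. -/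
theorem mem_unitarySpace_iff {k₀ : ℝ} (hk₀ : k₀ ≠ 0) (k : ℝ) (U : Matrix ι ι ℂ) (a b : ι → ℂ) :
    (a + b, (Complex.I * k) • (b - a)) ∈ unitarySpace k₀ U ↔
      U *ᵥ ((1 + (k / k₀ : ℝ) : ℂ) • a + (1 - (k / k₀ : ℝ) : ℂ) • b) =
        (1 - (k / k₀ : ℝ) : ℂ) • a + (1 + (k / k₀ : ℝ) : ℂ) • b := by
  have hk : (k₀ : ℂ) ≠ 0 := by exact_mod_cast hk₀
  simp only [unitarySpace, bcSpace, LinearMap.mem_ker, LinearMap.coprod_apply, mulVecLin_apply,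
    smul_mulVec, sub_mulVec, add_mulVec, one_mulVec, mulVec_add, mulVec_smul, mulVec_sub]
  rw [← sub_eq_zero (a := (1 + (k / k₀ : ℝ) : ℂ) • U *ᵥ a + _)]
  have h2 : (-(1 / 2 : ℂ)) ≠ 0 := by norm_num
  rw [← smul_eq_zero_iff_right h2 (m := (1 + (k / k₀ : ℝ) : ℂ) • U *ᵥ a + _ - _)]
  refine Eq.congr ?_ rfl
  have h3 : (Complex.I * k) * (1 / (2 * Complex.I * (k₀ : ℂ))) = 1 / 2 * ((k / k₀ : ℝ) : ℂ) := by
    push_cast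
    field_simp
  simp only [smul_add, smul_sub, smul_smul, h3]
  module

end Energy

/-! ### Block diagonal matrices over the vertices -/

namespace OpenGraph

open Matrix

variable {V I E R : Type*} [DecidableEq V] (G : OpenGraph V I E)

/-- The matrix on all ends with the diagonal blocks `M v`. -/
def blockMatrix [Zero R] (M : ∀ v, Matrix (G.Star v) (G.Star v) R) :
    Matrix (Ends I E) (Ends I E) R :=
  reindex (Equiv.sigmaFiberEquiv G.vertexOf) (Equiv.sigmaFiberEquiv G.vertexOf) (blockDiagonal' M)

theorem blockMatrix_apply_of_ne [Zero R] (M : ∀ v, Matrix (G.Star v) (G.Star v) R)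
    {x y : Ends I E} (h : G.vertexOf x ≠ G.vertexOf y) : G.blockMatrix M x y = 0 :=
  blockDiagonal'_apply_ne M _ _ h

theorem blockMatrix_apply_coe [Zero R] (M : ∀ v, Matrix (G.Star v) (G.Star v) R) {v : V}
    (x y : G.Star v) : G.blockMatrix M x y = M v x y := by
  obtain ⟨x, rfl⟩ := x
  obtain ⟨y, hy⟩ := y
  rw [← blockDiagonal'_apply_eq M]
  simp only [blockMatrix, reindex_apply, submatrix_apply]
  congr 1
  exact Sigma.ext hy (by
    simp only [Equiv.sigmaFiberEquiv, Equiv.coe_fn_symm_mk]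
    exact Subtype.heq_iff_coe_eq (by simp [hy]) |>.2 rfl)

theorem blockMatrix_map {R' : Type*} [Zero R] [Zero R'] (M : ∀ v, Matrix (G.Star v) (G.Star v) R)
    (f : R → R') (hf : f 0 = 0) :
    (G.blockMatrix M).map f = G.blockMatrix fun v => (M v).map f := by
  rw [blockMatrix, blockMatrix, ← blockDiagonal'_map _ _ hf]
  rfl

variable [Fintype I] [Fintype E]

theorem blockMatrix_mulVec_apply (M : ∀ v, Matrix (G.Star v) (G.Star v) ℂ) (u : Ends I E → ℂ)
    {v : V} (x : G.Star v) : (G.blockMatrix M *ᵥ u) x = (M v *ᵥ fun y : G.Star v => u y) x := by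
  rw [mulVec, dotProduct, mulVec, dotProduct]
  have h1 : ∑ y, G.blockMatrix M x y * u y =
      ∑ y ∈ Finset.univ.filter fun y => G.vertexOf y = v, G.blockMatrix M x y * u y := by
    refine (Finset.sum_subset (Finset.filter_subset _ _) fun y _ hy => ?_).symm
    rw [blockMatrix_apply_of_ne, zero_mul]
    rw [x.2]
    simpa [eq_comm] using hy
  rw [h1, Finset.sum_subtype (p := fun y => G.vertexOf y = v) _ (by simp)]
  exact Finset.sum_congr rfl fun y _ => by rw [blockMatrix_apply_coe]

/-- Boundary values in an orthogonal sum over the vertices are described by a block diagonal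
scattering matrix if all its summands are described by the blocks. -/
theorem mem_vertexSum_iff {M : ∀ v, Submodule ℂ ((G.Star v → ℂ) × (G.Star v → ℂ))}
    {S : ∀ v, Matrix (G.Star v) (G.Star v) ℂ} {c : ℂ}
    (h : ∀ v (a b : G.Star v → ℂ), (a + b, c • (b - a)) ∈ M v ↔ b = S v *ᵥ a)
    (a b : Ends I E → ℂ) :
    (a + b, c • (b - a)) ∈ G.vertexSum M ↔ b = G.blockMatrix S *ᵥ a := by
  rw [vertexSum, Submodule.mem_iInf]
  have h1 : ∀ v, (a + b, c • (b - a)) ∈ (M v).comap (LinearMap.prodMap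
      (LinearMap.funLeft ℂ ℂ (Subtype.val : G.Star v → Ends I E))
      (LinearMap.funLeft ℂ ℂ (Subtype.val : G.Star v → Ends I E))) ↔
      (fun x : G.Star v => b x) = S v *ᵥ fun x : G.Star v => a x := fun v => h v _ _
  simp only [h1]
  constructor
  · intro h2
    ext x
    have := congrFun (h2 (G.vertexOf x)) ⟨x, rfl⟩
    rw [← blockMatrix_mulVec_apply] at this
    exact this
  · rintro h2 v
    ext x
    rw [← blockMatrix_mulVec_apply, ← h2]

variable [Fintype V] [DecidableEq I] [DecidableEq E]

theorem blockMatrix_mem_unitaryGroup {M : ∀ v, Matrix (G.Star v) (G.Star v) ℂ}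
    (hM : ∀ v, M v ∈ unitaryGroup (G.Star v) ℂ) :
    G.blockMatrix M ∈ unitaryGroup (Ends I E) ℂ := by
  rw [mem_unitaryGroup_iff, star_eq_conjTranspose, blockMatrix, conjTranspose_reindex,
    blockDiagonal'_conjTranspose, reindex_apply, reindex_apply,
    submatrix_mul_equiv, ← blockDiagonal'_mul]
  have : (fun v => M v * (M v)ᴴ) = 1 := funext fun v => mem_unitaryGroup_iff.1 (hM v)
  rw [this, blockDiagonal'_one]
  simp

end OpenGraph

/-! ### Propagation along the internal edges -/

section Propagation

open Matrix Filter Topology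

variable {I E : Type*}

/-- The amplitudes that arrive at the ends of the edges after outgoing amplitudes `u` have
travelled along the internal edges, which multiply them by the factors `z i`. -/
def propagate (z : I → ℂ) : (Ends I E → ℂ) →ₗ[ℂ] (Ends I E → ℂ) where
  toFun u := Sum.elim 0 (Sum.elim (fun i => z i * u (.inr (.inr i))) fun i => z i * u (.inr (.inl i)))
  map_add' u w := by
    ext x; rcases x with e | i | i <;> simp [mul_add]
  map_smul' c u := by
    ext x; rcases x with e | i | i <;> simp [mul_left_comm]

@[simp] theorem propagate_ext (z : I → ℂ) (u : Ends I E → ℂ) (e : E) :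
    propagate z u (.inl e) = 0 := rfl

@[simp] theorem propagate_ini (z : I → ℂ) (u : Ends I E → ℂ) (i : I) :
    propagate z u (.inr (.inl i)) = z i * u (.inr (.inr i)) := rfl

@[simp] theorem propagate_ter (z : I → ℂ) (u : Ends I E → ℂ) (i : I) :
    propagate z u (.inr (.inr i)) = z i * u (.inr (.inl i)) := rfl

variable [Fintype I] [Fintype E]

theorem energy_eq_sum (u : Ends I E → ℂ) :
    energy u = ∑ e, ‖u (.inl e)‖ ^ 2 +
      (∑ i, ‖u (.inr (.inl i))‖ ^ 2 + ∑ i, ‖u (.inr (.inr i))‖ ^ 2) := by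
  simp [energy]

/-- The energy that leaves the graph through the external edges is lost in the propagation. -/
theorem energy_propagate {z : I → ℂ} (hz : ∀ i, ‖z i‖ = 1) (u : Ends I E → ℂ) :
    energy (propagate z u) + ∑ e, ‖u (.inl e)‖ ^ 2 = energy u := by
  simp [energy_eq_sum, hz]
  ring

variable [DecidableEq E] [DecidableEq I]

/-- The unit incoming amplitude on the external edge `e'`. -/
def incoming (e' : E) : Ends I E → ℂ := Pi.single (.inl e') 1

theorem energy_incoming_add (e' : E) (z : I → ℂ) (u : Ends I E → ℂ) :
    energy (incoming e' + propagate z u) = 1 + energy (propagate z u) := by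
  have h : ∑ e, ‖(Pi.single (.inl e') 1 : Ends I E → ℂ) (.inl e)‖ ^ 2 = 1 := by
    rw [Finset.sum_eq_single e'] <;> simp +contextual
  simp [energy_eq_sum, incoming, h]

/-- The outgoing amplitudes after `m` steps, for a constant unit incoming amplitude on the external
edge `e'`. -/
noncomputable def outgoing (S : Matrix (Ends I E) (Ends I E) ℂ) (z : I → ℂ) (e' : E) :
    ℕ → Ends I E → ℂ
  | 0 => 0
  | m + 1 => S *ᵥ (incoming e' + propagate z (outgoing S z e' m))

variable {S : Matrix (Ends I E) (Ends I E) ℂ} (hS : S ∈ unitaryGroup (Ends I E) ℂ)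
  {z : I → ℂ} (hz : ∀ i, ‖z i‖ = 1) (e' : E)

include hS hz

/-- The stationary scattering problem has a solution. -/
theorem exists_stationary : ∃ u : Ends I E → ℂ, u = S *ᵥ (incoming e' + propagate z u) := by
  set L : (Ends I E → ℂ) →ₗ[ℂ] (Ends I E → ℂ) := LinearMap.id - S.mulVecLin ∘ₗ propagate z with hL
  suffices h : S *ᵥ incoming e' ∈ LinearMap.range L by
    obtain ⟨u, hu⟩ := h
    refine ⟨u, ?_⟩
    rw [mulVec_add, ← hu]
    simp [hL]
  -- Fredholm alternative: a functional that kills the range of `L` but not the source is a dual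
  -- stationary state. It loses no energy, so its external components vanish, and therefore it kills
  -- the source.
  by_contra hn
  obtain ⟨φ, hφ, hφL⟩ := Submodule.exists_le_ker_of_notMem hn
  set y : Ends I E → ℂ := fun x => φ (Pi.single x 1)
  have hφy : ∀ u, φ u = y ⬝ᵥ u := by
    intro u
    conv_lhs => rw [← Finset.univ_sum_single u]
    rw [map_sum, dotProduct]
    refine Finset.sum_congr rfl fun x _ => ?_
    rw [mul_comm, ← smul_eq_mul, ← map_smul]
    congr 1
    ext w
    simp [Pi.single_apply]
  set w : Ends I E → ℂ := y ᵥ* S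
  have hw : ∀ u, y ⬝ᵥ (S *ᵥ u) = w ⬝ᵥ u := fun u => dotProduct_mulVec _ _ _
  have hyw : y = propagate z w := by
    ext x
    have h1 : φ (L (Pi.single x 1)) = 0 := hφL ⟨_, rfl⟩
    simp only [hL, LinearMap.sub_apply, LinearMap.id_apply, LinearMap.comp_apply,
      mulVecLin_apply, hφy, dotProduct_sub, hw, sub_eq_zero, dotProduct_single_one] at h1
    rw [h1]
    rcases x with e | i | i
    · simp [dotProduct]
    · simp [dotProduct, Pi.single_apply, mul_comm]
    · simp [dotProduct, Pi.single_apply, mul_comm]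
  have hen : energy w = energy y := by
    have := energy_mulVec (transpose_mem_unitaryGroup hS) y
    rwa [mulVec_transpose] at this
  have h0 := energy_propagate hz w
  rw [← hyw, hen, add_eq_left, Finset.sum_eq_zero_iff_of_nonneg fun _ _ => by positivity] at h0
  have h1 : w (.inl e') = 0 := by simpa using h0 e' (Finset.mem_univ _)
  apply hφ
  rw [hφy, hw, incoming, dotProduct_single_one, h1]

/-- The outgoing amplitudes on the external edges converge to those of any stationary solution. -/
theorem tendsto_outgoing {u : Ends I E → ℂ} (hu : u = S *ᵥ (incoming e' + propagate z u)) (e : E) :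
    Tendsto (fun m => outgoing S z e' m (.inl e)) atTop (𝓝 (u (.inl e))) := by
  set d : ℕ → Ends I E → ℂ := fun m => u - outgoing S z e' m
  -- The error obeys the recursion without source, so its external part is exactly the energy lost
  -- in one step, which telescopes.
  have hd : ∀ m, ∑ e, ‖d m (.inl e)‖ ^ 2 = energy (d m) - energy (d (m + 1)) := by
    intro m
    have h1 : d (m + 1) = S *ᵥ propagate z (d m) := by
      simp only [d, outgoing]
      conv_lhs => rw [hu]
      rw [← mulVec_sub, map_sub]
      congr 1
      abel
    rw [h1, energy_mulVec hS, ← energy_propagate hz (d m)]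
    ring
  have hsum : Summable fun m => ∑ e, ‖d m (.inl e)‖ ^ 2 := by
    refine summable_of_sum_range_le (c := energy (d 0))
      (fun m => Finset.sum_nonneg fun _ _ => by positivity) fun m => ?_
    simp only [hd]
    rw [Finset.sum_range_sub' (fun m => energy (d m))]
    linarith [energy_nonneg (d m)]
  have h2 : Tendsto (fun m => ‖d m (.inl e)‖ ^ 2) atTop (𝓝 0) :=
    squeeze_zero (fun m => by positivity)
      (fun m => Finset.single_le_sum (f := fun e => ‖d m (.inl e)‖ ^ 2)
        (fun _ _ => by positivity) (Finset.mem_univ e)) hsum.tendsto_atTop_zero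
  have h3 : Tendsto (fun m => d m (.inl e)) atTop (𝓝 0) := by
    rw [tendsto_zero_iff_norm_tendsto_zero]
    simpa using h2.sqrt
  have h4 := h3.const_sub (u (.inl e))
  simpa [d] using h4

/-- Energy balance: each step injects one unit and loses the external outgoing energy, starting from
zero energy. -/
theorem sum_norm_sq_outgoing_le (e : E) (M : ℕ) :
    ∑ m ∈ Finset.range M, ‖outgoing S z e' m (.inl e)‖ ^ 2 ≤ M := by
  have h1 : ∀ m, ‖outgoing S z e' m (.inl e)‖ ^ 2 ≤
      1 + (energy (outgoing S z e' m) - energy (outgoing S z e' (m + 1))) := by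
    intro m
    have h2 : energy (outgoing S z e' (m + 1)) = 1 + energy (propagate z (outgoing S z e' m)) := by
      rw [outgoing, energy_mulVec hS, energy_incoming_add]
    rw [h2]
    have h3 := energy_propagate hz (outgoing S z e' m)
    have h4 := Finset.single_le_sum (f := fun e => ‖outgoing S z e' m (.inl e)‖ ^ 2)
        (fun _ _ => by positivity) (Finset.mem_univ e)
    linarith
  refine (Finset.sum_le_sum fun m _ => h1 m).trans ?_
  rw [Finset.sum_add_distrib, Finset.sum_range_sub' (fun m => energy (outgoing S z e' m))]
  have : energy (outgoing S z e' 0) = 0 := by simp [outgoing, energy]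
  simp [this, energy_nonneg]

/-- Cauchy–Schwarz turns the balance into a bound independent of `z` and `M`, the dominating
function for the Fourier integrals. -/
theorem norm_cesaro_outgoing_le (e : E) (M : ℕ) :
    ‖(M : ℝ)⁻¹ • ∑ m ∈ Finset.range M, outgoing S z e' m (.inl e)‖ ≤ 1 := by
  rcases Nat.eq_zero_or_pos M with rfl | hM
  · simp
  have h1 : ‖∑ m ∈ Finset.range M, outgoing S z e' m (.inl e)‖ ^ 2 ≤ (M : ℝ) ^ 2 := by
    have h2 : (∑ m ∈ Finset.range M, ‖outgoing S z e' m (.inl e)‖) ^ 2 ≤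
        M * ∑ m ∈ Finset.range M, ‖outgoing S z e' m (.inl e)‖ ^ 2 := by
      simpa using sq_sum_le_card_mul_sum_sq (s := Finset.range M)
        (f := fun m => ‖outgoing S z e' m (.inl e)‖)
    calc _ ≤ (∑ m ∈ Finset.range M, ‖outgoing S z e' m (.inl e)‖) ^ 2 := by
          gcongr
          exact norm_sum_le _ _
      _ ≤ _ := h2
      _ ≤ M * M := by
          gcongr
          exact sum_norm_sq_outgoing_le hS hz e' e M
      _ = _ := by ring
  have h3 := abs_le_of_sq_le_sq h1 (by positivity)
  rw [norm_smul, norm_inv, Real.norm_natCast, inv_mul_le_iff₀ (by positivity), mul_one]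
  simpa using h3

end Propagation

/-! ### Expansion of the outgoing amplitudes in powers of the edge factors -/

section WalkPolynomial

open Matrix MvPolynomial

variable {I E R : Type*} [Fintype I] [CommSemiring R]

/-- The outgoing amplitudes after the traversal of `m` internal edges, as polynomials in the factors
of the internal edges. -/
noncomputable def walkPoly (S : Matrix (Ends I E) (Ends I E) R) (e' : E) :
    ℕ → Ends I E → MvPolynomial I R
  | 0, x => C (S x (.inl e'))
  | m + 1, x => ∑ i, X i * (C (S x (.inr (.inl i))) * walkPoly S e' m (.inr (.inr i)) +
      C (S x (.inr (.inr i))) * walkPoly S e' m (.inr (.inl i)))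

/-- Used for the cast from `ℕ`, where positivity excludes cancellation, and for complex conjugation.
-/
theorem walkPoly_map {R' : Type*} [CommSemiring R'] (f : R →+* R')
    (S : Matrix (Ends I E) (Ends I E) R) (e' : E) (m : ℕ) (x : Ends I E) :
    walkPoly (S.map f) e' m x = map f (walkPoly S e' m x) := by
  induction m generalizing x with
  | zero => simp [walkPoly]
  | succ m ih => simp [walkPoly, ih]

/-- A monomial thus occurs in one degree only, so its coefficient in the partial sums stabilises. -/
theorem isHomogeneous_walkPoly (S : Matrix (Ends I E) (Ends I E) R) (e' : E) (m : ℕ)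
    (x : Ends I E) : (walkPoly S e' m x).IsHomogeneous m := by
  induction m generalizing x with
  | zero => exact isHomogeneous_C _ _
  | succ m ih =>
    refine IsHomogeneous.sum _ _ _ fun i _ => ?_
    rw [add_comm m 1]
    refine (isHomogeneous_X _ _).mul (IsHomogeneous.add ?_ ?_)
    · simpa using (isHomogeneous_C I _).mul (ih (.inr (.inr i)))
    · simpa using (isHomogeneous_C I _).mul (ih (.inr (.inl i)))

theorem coeff_walkPoly_succ [DecidableEq I] (S : Matrix (Ends I E) (Ends I E) R) (e' : E) (m : ℕ)
    (x : Ends I E) (d : I →₀ ℕ) :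
    coeff d (walkPoly S e' (m + 1) x) = ∑ i, if i ∈ d.support then
      S x (.inr (.inl i)) * coeff (d - Finsupp.single i 1) (walkPoly S e' m (.inr (.inr i))) +
      S x (.inr (.inr i)) * coeff (d - Finsupp.single i 1) (walkPoly S e' m (.inr (.inl i)))
      else 0 := by
  rw [walkPoly, coeff_sum]
  refine Finset.sum_congr rfl fun i _ => ?_
  rw [coeff_X_mul', coeff_add, coeff_C_mul, coeff_C_mul]

theorem outgoing_eq_eval [Fintype E] [DecidableEq E] [DecidableEq I]
    (S : Matrix (Ends I E) (Ends I E) ℂ) (z : I → ℂ) (e' : E) (m : ℕ) (x : Ends I E) :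
    outgoing S z e' m x = eval z (∑ j ∈ Finset.range m, walkPoly S e' j x) := by
  induction m generalizing x with
  | zero => simp [outgoing]
  | succ m ih =>
    rw [outgoing, mulVec_add, Pi.add_apply, incoming, mulVec_single_one, Finset.sum_range_succ',
      map_add, add_comm]
    congr 1
    · simp only [mulVec, dotProduct, Fintype.sum_sum_type, propagate_ext, propagate_ini,
        propagate_ter, ih, mul_zero, Finset.sum_const_zero, zero_add, walkPoly, map_sum, map_mul,
        map_add, eval_X, eval_C]
      rw [Finset.sum_comm (s := Finset.range m), ← Finset.sum_add_distrib]
      refine Finset.sum_congr rfl fun i _ => ?_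
      rw [← Finset.mul_sum, Finset.sum_add_distrib, ← Finset.mul_sum, ← Finset.mul_sum]
      ring
    · simp [walkPoly]

end WalkPolynomial

/-! ### Fourier coefficients -/

section Fourier

open MeasureTheory Filter Topology Matrix MvPolynomial

theorem integral_Icc_exp {k : ℝ} (hk : 0 < k) (m : ℤ) :
    ∫ x in Set.Icc 0 (2 * Real.pi / k), Complex.exp (Complex.I * k * m * (x : ℂ)) =
      if m = 0 then ((2 * Real.pi / k : ℝ) : ℂ) else 0 := by
  have hT : 0 ≤ 2 * Real.pi / k := by positivity
  rw [integral_Icc_eq_integral_Ioc, ← intervalIntegral.integral_of_le hT]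
  split_ifs with h
  · simp [h]
  · have hk' : (k : ℂ) ≠ 0 := by exact_mod_cast hk.ne'
    have hm : (m : ℂ) ≠ 0 := by exact_mod_cast h
    rw [integral_exp_mul_complex (by simp [hk', hm])]
    have : Complex.I * k * m * ((2 * Real.pi / k : ℝ) : ℂ) = m * (2 * Real.pi * Complex.I) := by
      push_cast
      field_simp
    rw [this, Complex.exp_int_mul_two_pi_mul_I]
    simp

variable {I E : Type*} [Fintype I]

theorem integral_box_exp {k : ℝ} (hk : 0 < k) (m : I → ℤ) :
    ((k / (2 * Real.pi) : ℝ) : ℂ) ^ Fintype.card I *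
      ∫ a in Set.Icc (0 : I → ℝ) (fun _ => 2 * Real.pi / k),
        Complex.exp (Complex.I * k * ∑ i, (m i : ℂ) * (a i : ℂ)) = if m = 0 then 1 else 0 := by
  have h1 : ∀ a : I → ℝ, Complex.exp (Complex.I * k * ∑ i, (m i : ℂ) * (a i : ℂ)) =
      ∏ i, Complex.exp (Complex.I * k * m i * (a i : ℂ)) := by
    intro a
    rw [← Complex.exp_sum, Finset.mul_sum]
    congr 1
    exact Finset.sum_congr rfl fun i _ => by ring
  simp only [h1]
  rw [← Set.pi_univ_Icc, volume_pi, Measure.restrict_pi_pi,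
    integral_fintype_prod_eq_prod (fun i (x : ℝ) => Complex.exp (Complex.I * k * m i * (x : ℂ)))]
  simp only [Pi.zero_apply, integral_Icc_exp hk]
  split_ifs with h
  · subst h
    simp only [Pi.zero_apply, if_true, Finset.prod_const, Finset.card_univ]
    rw [← mul_pow]
    have : ((k / (2 * Real.pi) : ℝ) : ℂ) * ((2 * Real.pi / k : ℝ) : ℂ) = 1 := by
      have := hk.ne'
      rw [← Complex.ofReal_mul, ← Complex.ofReal_one]
      congr 1
      field_simp
    rw [this, one_pow]
  · obtain ⟨i, hi⟩ := Function.ne_iff.1 h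
    rw [Finset.prod_eq_zero (Finset.mem_univ i) (if_neg hi), mul_zero]

/-- The factor that a wave acquires on an internal edge of length `a i`. -/
noncomputable def edgeFactor (k : ℝ) (a : I → ℝ) (i : I) : ℂ := Complex.exp (Complex.I * k * a i)

omit [Fintype I] in
theorem norm_edgeFactor (k : ℝ) (a : I → ℝ) (i : I) : ‖edgeFactor k a i‖ = 1 := by
  rw [edgeFactor, show Complex.I * k * a i = ((k * a i : ℝ) : ℂ) * Complex.I by push_cast; ring]
  exact Complex.norm_exp_ofReal_mul_I _

omit [Fintype I] in
theorem continuous_edgeFactor (k : ℝ) : Continuous (edgeFactor k : (I → ℝ) → I → ℂ) := by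
  unfold edgeFactor
  fun_prop

/-- The Fourier coefficient of a function of the lengths of the internal edges. -/
noncomputable def boxCoeff (k : ℝ) (n : I → ℤ) (F : (I → ℝ) → ℂ) : ℂ :=
  ((k / (2 * Real.pi) : ℝ) : ℂ) ^ Fintype.card I *
    ∫ a in Set.Icc (0 : I → ℝ) (fun _ => 2 * Real.pi / k),
      F a * Complex.exp (-(Complex.I * k * ∑ i, (n i : ℂ) * (a i : ℂ)))

theorem boxCoeff_eval {k : ℝ} (hk : 0 < k) (n : I → ℤ) (p : MvPolynomial I ℂ) :
    boxCoeff k n (fun a => eval (edgeFactor k a) p) =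
      ∑ d ∈ p.support, if (fun i => (d i : ℤ)) = n then coeff d p else 0 := by
  have h1 : ∀ a : I → ℝ, eval (edgeFactor k a) p *
      Complex.exp (-(Complex.I * k * ∑ i, (n i : ℂ) * (a i : ℂ))) =
      ∑ d ∈ p.support, coeff d p *
        Complex.exp (Complex.I * k * ∑ i, (((d i : ℤ) - n i : ℤ) : ℂ) * (a i : ℂ)) := by
    intro a
    rw [eval_eq', Finset.sum_mul]
    refine Finset.sum_congr rfl fun d _ => ?_
    rw [mul_assoc]
    congr 1
    simp only [edgeFactor, ← Complex.exp_nat_mul]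
    rw [← Complex.exp_sum, ← Complex.exp_add, Finset.mul_sum, Finset.mul_sum,
      ← sub_eq_add_neg, ← Finset.sum_sub_distrib]
    congr 1
    refine Finset.sum_congr rfl fun i _ => ?_
    push_cast
    ring
  rw [boxCoeff]
  simp only [h1]
  rw [integral_finsetSum, Finset.mul_sum]
  · refine Finset.sum_congr rfl fun d _ => ?_
    rw [integral_const_mul, mul_left_comm, integral_box_exp hk]
    have : (fun i => (d i : ℤ) - n i) = 0 ↔ (fun i => (d i : ℤ)) = n := by
      simp only [funext_iff, Pi.zero_apply, sub_eq_zero]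
    simp only [this]
    split_ifs <;> simp
  · intro d _
    refine Continuous.integrableOn_Icc ?_
    fun_prop

theorem tendsto_boxCoeff (k : ℝ) (n : I → ℤ) {F : (I → ℝ) → ℂ} {σ : ℕ → (I → ℝ) → ℂ}
    (hc : ∀ M, Continuous (σ M)) (hb : ∀ M a, ‖σ M a‖ ≤ 1)
    (hlim : ∀ a, Tendsto (fun M => σ M a) atTop (𝓝 (F a))) :
    Tendsto (fun M => boxCoeff k n (σ M)) atTop (𝓝 (boxCoeff k n F)) := by
  refine Tendsto.const_mul _ ?_
  refine tendsto_integral_of_dominated_convergence (fun _ => (1 : ℝ)) (fun M => ?_)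
    (integrableOn_const isCompact_Icc.measure_lt_top.ne) (fun M => ?_) ?_
  · refine Continuous.aestronglyMeasurable ?_
    have := hc M
    fun_prop
  · refine Eventually.of_forall fun a => ?_
    have h1 : ‖Complex.exp (-(Complex.I * k * ∑ i, (n i : ℂ) * (a i : ℂ)))‖ = 1 := by
      rw [show -(Complex.I * k * ∑ i, (n i : ℂ) * (a i : ℂ)) =
        ((-(k * ∑ i, (n i : ℝ) * a i) : ℝ) : ℂ) * Complex.I by push_cast; ring]
      exact Complex.norm_exp_ofReal_mul_I _
    rw [norm_mul, h1, mul_one]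
    exact hb M a
  · exact Eventually.of_forall fun a => (hlim a).mul_const _

variable [Fintype E] [DecidableEq E] [DecidableEq I]

omit [Fintype I] [Fintype E] [DecidableEq I] in
theorem extWave_zero (k : ℝ) (e' e : E) (s : ℂ) :
    extWave k e' e s 0 = (if e = e' then 1 else 0) + s := by
  simp [extWave]

omit [Fintype I] [Fintype E] [DecidableEq I] in
theorem deriv_extWave_zero (k : ℝ) (e' e : E) (s : ℂ) :
    deriv (extWave k e' e s) 0 = Complex.I * k * (s - if e = e' then 1 else 0) := by
  have h0 : HasDerivAt (fun x : ℝ => Complex.I * k * (x : ℂ)) (Complex.I * k) 0 := by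
    simpa using (Complex.ofRealCLM.hasDerivAt (x := (0 : ℝ))).const_mul (Complex.I * k)
  have h1 := (h0.cexp).const_mul s
  have h2 := h0.fun_neg.cexp
  by_cases h : e = e'
  · have h3 := (h2.add h1).deriv
    simp only [Complex.ofReal_zero, mul_zero, neg_zero, Complex.exp_zero, one_mul] at h3
    rw [if_pos h]
    refine Eq.trans ?_ (h3.trans (by ring))
    congr 1
    ext x
    simp [extWave, h]
  · have h3 := h1.deriv
    simp only [Complex.ofReal_zero, mul_zero, Complex.exp_zero, one_mul] at h3
    rw [if_neg h]
    refine Eq.trans ?_ (h3.trans (by ring))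
    congr 1
    ext x
    simp [extWave, h]

omit [Fintype I] [Fintype E] [DecidableEq E] [DecidableEq I] in
theorem deriv_intWave (k : ℝ) (α β : ℂ) (x : ℝ) :
    deriv (intWave k α β) x = Complex.I * k *
      (α * Complex.exp (Complex.I * k * x) - β * Complex.exp (-(Complex.I * k * x))) := by
  have h0 : HasDerivAt (fun x : ℝ => Complex.I * k * (x : ℂ)) (Complex.I * k) x := by
    simpa using (Complex.ofRealCLM.hasDerivAt (x := x)).const_mul (Complex.I * k)
  have h3 := ((h0.cexp.const_mul α).add (h0.fun_neg.cexp.const_mul β)).deriv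
  refine Eq.trans ?_ (h3.trans (by ring))
  rfl

/-- The outgoing amplitudes at all ends for a wave with parameters `s`, `α`, `β`. -/
noncomputable def outgoingOf (z : I → ℂ) (s : E → ℂ) (α β : I → ℂ) : Ends I E → ℂ :=
  Sum.elim s (Sum.elim α fun i => (z i)⁻¹ * β i)

/-- The matrix `S` describes the boundary conditions `(A, B)` at the energy `k ^ 2`: it maps the
incoming to the outgoing amplitudes. -/
def IsVertexScattering (A B : Matrix (Ends I E) (Ends I E) ℂ) (k : ℝ)
    (S : Matrix (Ends I E) (Ends I E) ℂ) : Prop :=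
  ∀ a b : Ends I E → ℂ, (a + b, (Complex.I * k) • (b - a)) ∈ bcSpace A B ↔ b = S *ᵥ a

/-- Outgoing amplitudes on `i` are `α i` at the initial end and `β i / z i` at the terminal end;
incoming ones are `β i` and `z i * α i`. The sign in `-ψ'(a)` makes both derivatives point into the
edge. -/
theorem isScatteringSolution_iff {A B S : Matrix (Ends I E) (Ends I E) ℂ} {k : ℝ}
    (h : IsVertexScattering A B k S) (a : I → ℝ) (e' : E) (s : E → ℂ) (α β : I → ℂ) :
    IsScatteringSolution A B k a e' s α β ↔
      outgoingOf (edgeFactor k a) s α β = S *ᵥ (incoming e' +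
        propagate (edgeFactor k a) (outgoingOf (edgeFactor k a) s α β)) := by
  rw [← h, bcSpace, LinearMap.mem_ker, LinearMap.coprod_apply, mulVecLin_apply, mulVecLin_apply,
    IsScatteringSolution]
  have hz : ∀ i, edgeFactor k a i ≠ 0 := fun i => Complex.exp_ne_zero _
  have hz' : ∀ i, Complex.exp (-(Complex.I * k * a i)) = (edgeFactor k a i)⁻¹ := fun i =>
    Complex.exp_neg _
  have hz'' : ∀ i, Complex.exp (Complex.I * k * a i) = edgeFactor k a i := fun i => rfl
  refine Eq.congr (congrArg₂ _ (congrArg _ ?_) (congrArg _ ?_)) rfl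
  · ext x
    rcases x with e | i | i
    · simp [outgoingOf, extWave_zero, incoming, Pi.single_apply]
    · simp [outgoingOf, intWave, incoming, hz]
      ring
    · simp [outgoingOf, intWave, incoming, hz', hz'']
      ring
  · ext x
    rcases x with e | i | i
    · simp [outgoingOf, deriv_extWave_zero, incoming, Pi.single_apply]
    · simp [outgoingOf, deriv_intWave, incoming, hz]
    · simp [outgoingOf, deriv_intWave, incoming, hz', hz'']
      ring

theorem tendsto_outgoing_scatteringMatrix {A B S : Matrix (Ends I E) (Ends I E) ℂ} {k : ℝ}
    (hS : S ∈ unitaryGroup (Ends I E) ℂ) (h : IsVertexScattering A B k S) (a : I → ℝ) (e e' : E) :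
    Tendsto (fun m => outgoing S (edgeFactor k a) e' m (.inl e)) atTop
      (𝓝 (scatteringMatrix A B k a e e')) := by
  have hz := norm_edgeFactor k a
  have hz0 : ∀ i, edgeFactor k a i ≠ 0 := fun i => Complex.exp_ne_zero _
  have hex : ∃ s : E → ℂ, ∃ α β : I → ℂ, IsScatteringSolution A B k a e' s α β := by
    obtain ⟨u, hu⟩ := exists_stationary hS hz e'
    refine ⟨fun e => u (.inl e), fun i => u (.inr (.inl i)),
      fun i => edgeFactor k a i * u (.inr (.inr i)), ?_⟩
    rw [isScatteringSolution_iff h]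
    convert hu using 1
    · ext x
      rcases x with e | i | i <;> simp [outgoingOf, hz0]
    · congr 3
      ext x
      rcases x with e | i | i <;> simp [outgoingOf, hz0]
  -- The limit is the same for every stationary solution, so the choice of one in the definition is
  -- harmless.
  rw [scatteringMatrix, dif_pos hex]
  obtain ⟨α, β, hsol⟩ := hex.choose_spec
  rw [isScatteringSolution_iff h] at hsol
  exact tendsto_outgoing hS hz e' hsol e

theorem tendsto_fourierCoeff {A B S : Matrix (Ends I E) (Ends I E) ℂ} {k : ℝ}
    (hS : S ∈ unitaryGroup (Ends I E) ℂ) (h : IsVertexScattering A B k S) (n : I → ℤ) (e e' : E) :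
    Tendsto (fun M : ℕ => (M : ℝ)⁻¹ • ∑ m ∈ Finset.range M, boxCoeff k n fun a =>
      eval (edgeFactor k a) (∑ j ∈ Finset.range m, walkPoly S e' j (.inl e))) atTop
      (𝓝 (fourierCoeff A B k n e e')) := by
  set σ : ℕ → (I → ℝ) → ℂ := fun M a =>
    (M : ℝ)⁻¹ • ∑ m ∈ Finset.range M, outgoing S (edgeFactor k a) e' m (.inl e)
  have hcont : ∀ p : MvPolynomial I ℂ, Continuous fun a => eval (edgeFactor k a) p := fun p =>
    (MvPolynomial.continuous_eval p).comp (continuous_edgeFactor k)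
  have h1 : Tendsto (fun M => boxCoeff k n (σ M)) atTop (𝓝 (fourierCoeff A B k n e e')) := by
    refine tendsto_boxCoeff k n (fun M => ?_)
      (fun M a => norm_cesaro_outgoing_le hS (norm_edgeFactor k a) e' e M)
      fun a => (tendsto_outgoing_scatteringMatrix hS h a e e').cesaro_smul
    simp only [σ, outgoing_eq_eval]
    exact Continuous.const_smul (continuous_finsetSum _ fun m _ => hcont _) (M : ℝ)⁻¹
  convert h1 using 2 with M
  simp only [σ, boxCoeff, outgoing_eq_eval, Complex.real_smul, Finset.sum_mul, mul_assoc]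
  rw [integral_const_mul, integral_finsetSum, Finset.mul_sum, Finset.mul_sum, Finset.mul_sum]
  · exact Finset.sum_congr rfl fun m _ => by ring
  · intro m _
    refine Continuous.integrableOn_Icc ?_
    exact (hcont _).mul (by fun_prop)

/-- The Fourier coefficients of the scattering matrix are coefficients of the walk polynomials. -/
theorem fourierCoeff_eq_coeff {A B S : Matrix (Ends I E) (Ends I E) ℂ} {k : ℝ} (hk : 0 < k)
    (hS : S ∈ unitaryGroup (Ends I E) ℂ) (h : IsVertexScattering A B k S) (d : I →₀ ℕ) (e e' : E) :
    fourierCoeff A B k (fun i => (d i : ℤ)) e e' = coeff d (walkPoly S e' d.degree (.inl e)) := by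
  refine tendsto_nhds_unique (tendsto_fourierCoeff hS h _ e e')
    (Tendsto.cesaro_smul (tendsto_const_nhds.congr' ?_))
  -- The `m`-th partial sum has the degrees below `m`, so it contains degree `|d|` once `m > |d|`.
  filter_upwards [eventually_gt_atTop d.degree] with m hm
  rw [boxCoeff_eval hk]
  have h1 : ∀ d' : I →₀ ℕ, (fun i => (d' i : ℤ)) = (fun i => (d i : ℤ)) ↔ d' = d := fun d' => by
    simp [funext_iff, DFunLike.ext_iff]
  simp only [h1, Finset.sum_ite_eq', mem_support_iff]
  rw [ite_not, ite_eq_right_iff.2 fun h => h.symm, coeff_sum,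
    Finset.sum_eq_single_of_mem d.degree (Finset.mem_range.2 hm)]
  intro j _ hj
  by_contra h0
  apply hj
  rw [← isHomogeneous_walkPoly S e' j (.inl e) h0, Finsupp.degree_eq_weight_one]
  rfl

theorem fourierCoeff_eq_zero_of_neg {A B S : Matrix (Ends I E) (Ends I E) ℂ} {k : ℝ} (hk : 0 < k)
    (hS : S ∈ unitaryGroup (Ends I E) ℂ) (h : IsVertexScattering A B k S) {n : I → ℤ} {i : I}
    (hi : n i < 0) (e e' : E) : fourierCoeff A B k n e e' = 0 := by
  refine tendsto_nhds_unique (tendsto_fourierCoeff hS h _ e e')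
    (Tendsto.cesaro_smul (tendsto_const_nhds.congr fun m => ?_))
  rw [boxCoeff_eval hk, Finset.sum_eq_zero]
  intro d _
  rw [if_neg]
  rintro rfl
  simp only at hi
  omega

end Fourier

/-! ### Walks and the coefficients of the walk polynomials -/

namespace OpenGraph

open Matrix MvPolynomial

variable {V I E : Type*} (G : OpenGraph V I E)

/-- The internal edge `i` can be traversed from `v` to `w`. -/
def Traverses (v : V) (i : I) (w : V) : Prop :=
  (v = G.ini i ∧ w = G.ter i) ∨ (v = G.ter i ∧ w = G.ini i)

/-- The condition on tadpoles only excludes staying at one end of an edge that is not a loop. -/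
theorem traverses_iff {v w : V} {i : I} :
    G.Incident v i ∧ G.Incident w i ∧ (v = w ↔ G.IsTadpole i) ↔ G.Traverses v i w := by
  simp only [Incident, IsTadpole, Traverses]
  constructor
  · rintro ⟨rfl | rfl, rfl | rfl, h⟩ <;> simp_all
  · rintro (⟨rfl, rfl⟩ | ⟨rfl, rfl⟩) <;> simp [eq_comm]

/-- The edges in the list can be traversed one after the other from `v` to `w`. -/
def Connects (v w : V) : List I → Prop
  | [] => v = w
  | i :: l => ∃ v', G.Traverses v i v' ∧ Connects v' w l

theorem connects_iff_exists (v w : V) (l : List I) :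
    G.Connects v w l ↔ ∃ f : Fin (l.length + 1) → V, f 0 = v ∧ f (Fin.last l.length) = w ∧
      ∀ k : Fin l.length, G.Traverses (f k.castSucc) (l.get k) (f k.succ) := by
  induction l generalizing v with
  | nil =>
    constructor
    · intro h
      exact ⟨fun _ => v, rfl, h, fun k => k.elim0⟩
    · rintro ⟨f, rfl, rfl, -⟩
      rfl
  | cons i l ih =>
    constructor
    · rintro ⟨v', h, h'⟩
      obtain ⟨f, rfl, hf, hl⟩ := (ih v').1 h'
      refine ⟨Fin.cons v f, rfl, hf, fun k => ?_⟩
      induction k using Fin.cases with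
      | zero => exact h
      | succ k => exact hl k
    · rintro ⟨f, rfl, rfl, hl⟩
      exact ⟨f 1, hl 0, (ih _).2 ⟨fun k => f k.succ, rfl, rfl, fun k => hl k.succ⟩⟩

theorem isWalk_iff_connects (e' e : E) (l : List I) :
    G.IsWalk e' e l ↔ G.Connects (G.ext e') (G.ext e) l := by
  rw [connects_iff_exists, IsWalk]
  simp only [traverses_iff]

/-- `Connects` peels off the first edge, while the recursion of `walkPoly` peels off the last. -/
theorem connects_append_singleton (v w : V) (l : List I) (i : I) :
    G.Connects v w (l ++ [i]) ↔ ∃ v', G.Connects v v' l ∧ G.Traverses v' i w := by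
  induction l generalizing v with
  | nil => simp [Connects]
  | cons j l ih =>
    simp only [List.cons_append, Connects, ih]
    constructor
    · rintro ⟨u, h1, v', h2, h3⟩
      exact ⟨v', ⟨u, h1, h2⟩, h3⟩
    · rintro ⟨v', ⟨u, h1, h2⟩, h3⟩
      exact ⟨u, h1, v', h2, h3⟩

section Coefficients

variable [Fintype I] [DecidableEq I] {R : Type*} [CommSemiring R]

/-- For a matrix without transitions between different vertices, nonzero coefficients of the walk
polynomials come from walks. -/
theorem exists_connects_of_coeff_ne_zero {S : Matrix (Ends I E) (Ends I E) R}
    (hS : ∀ x y, G.vertexOf x ≠ G.vertexOf y → S x y = 0) {e' : E} {m : ℕ} {x : Ends I E}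
    {d : I →₀ ℕ} (h : coeff d (walkPoly S e' m x) ≠ 0) :
    ∃ l, G.Connects (G.ext e') (G.vertexOf x) l ∧ ∀ i, l.count i = d i := by
  induction m generalizing x d with
  | zero =>
    rw [walkPoly, coeff_C] at h
    split_ifs at h with hd
    · refine ⟨[], ?_, fun i => by simp [← hd]⟩
      by_contra hne
      exact h (hS _ _ fun h' => hne h'.symm)
    · exact absurd rfl h
  | succ m ih =>
    -- The last edge `i` is left at the end `y'` and reached at the end `y`; both directions of
    -- traversal are covered.
    have key : ∀ (i : I) (y y' : Ends I E), i ∈ d.support →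
        G.Traverses (G.vertexOf y') i (G.vertexOf y) →
        S x y * coeff (d - Finsupp.single i 1) (walkPoly S e' m y') ≠ 0 →
        ∃ l, G.Connects (G.ext e') (G.vertexOf x) l ∧ ∀ i, l.count i = d i := by
      intro i y y' hi ht hne
      obtain ⟨l, hl, hc⟩ := ih (right_ne_zero_of_mul hne)
      have hxy : G.vertexOf x = G.vertexOf y := by
        by_contra hxy
        exact left_ne_zero_of_mul hne (hS _ _ hxy)
      refine ⟨l ++ [i], (G.connects_append_singleton _ _ _ _).2 ⟨_, hl, hxy ▸ ht⟩, fun j => ?_⟩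
      have hi' : d i ≠ 0 := by simpa using hi
      rw [List.count_append, hc, Finsupp.tsub_apply, Finsupp.single_apply, List.count_singleton]
      by_cases hij : i = j
      · subst hij
        simp
        omega
      · simp [hij]
    rw [coeff_walkPoly_succ] at h
    obtain ⟨i, -, hi⟩ := Finset.exists_ne_zero_of_sum_ne_zero h
    split_ifs at hi with hid
    · by_cases h1 : S x (.inr (.inl i)) *
          coeff (d - Finsupp.single i 1) (walkPoly S e' m (.inr (.inr i))) = 0
      · rw [h1, zero_add] at hi
        exact key i _ _ hid (Or.inl ⟨rfl, rfl⟩) hi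
      · exact key i _ _ hid (Or.inr ⟨rfl, rfl⟩) h1
    · exact absurd rfl hi

/-- Every walk contributes to the walk polynomial of a matrix with positive integral transition
weights. -/
theorem coeff_walkPoly_ne_zero {S : Matrix (Ends I E) (Ends I E) ℕ}
    (hS : ∀ x y, G.vertexOf x = G.vertexOf y → S x y ≠ 0) {e' : E} {x : Ends I E} {l : List I}
    (hl : G.Connects (G.ext e') (G.vertexOf x) l) :
    coeff (Multiset.toFinsupp (l : Multiset I)) (walkPoly S e' l.length x) ≠ 0 := by
  induction l using List.reverseRecOn generalizing x with
  | nil =>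
    have : S x (.inl e') ≠ 0 := hS _ _ (Eq.symm hl)
    rw [List.length_nil, walkPoly, Multiset.coe_nil, map_zero, coeff_zero_C]
    exact this
  | append_singleton l i ih =>
    obtain ⟨v', h1, h2⟩ := (G.connects_append_singleton _ _ _ _).1 hl
    rw [List.length_append, List.length_singleton, coeff_walkPoly_succ]
    have hd : Multiset.toFinsupp ((l ++ [i] : List I) : Multiset I) - Finsupp.single i 1 =
        Multiset.toFinsupp (l : Multiset I) := by
      ext j
      rw [Finsupp.tsub_apply, Multiset.toFinsupp_apply, Multiset.toFinsupp_apply,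
        Finsupp.single_apply, Multiset.coe_count, Multiset.coe_count, List.count_append,
        List.count_singleton]
      by_cases hij : i = j <;> simp [hij]
    intro h0
    -- Over `ℕ` a sum vanishes only if every summand does.
    have h3 := Finset.sum_eq_zero_iff.1 h0 i (Finset.mem_univ i)
    rw [if_pos (by simp), hd, Nat.add_eq_zero_iff] at h3
    rcases h2 with ⟨rfl, h2⟩ | ⟨rfl, h2⟩
    · exact mul_ne_zero (hS _ _ h2) (ih (x := .inr (.inl i)) h1) h3.2
    · exact mul_ne_zero (hS _ _ h2) (ih (x := .inr (.inr i)) h1) h3.1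

end Coefficients

/-! ### Generic boundary conditions -/

section Generic

open scoped Matrix.Norms.L2Operator
open MeasureTheory

variable [Fintype V] [Fintype I] [Fintype E] [DecidableEq V] [DecidableEq I] [DecidableEq E]

omit [Fintype V] [DecidableEq I] [DecidableEq E] in
theorem differentiable_blockMatrix_apply (x y : Ends I E) :
    Differentiable ℂ fun M : ∀ v, Matrix (G.Star v) (G.Star v) ℂ => G.blockMatrix M x y := by
  by_cases h : G.vertexOf y = G.vertexOf x
  · have h1 : (fun M : ∀ v, Matrix (G.Star v) (G.Star v) ℂ => G.blockMatrix M x y) =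
        (LinearMap.toContinuousLinearMap (entryLinearMap ℂ ℂ (⟨x, rfl⟩ : G.Star (G.vertexOf x))
          (⟨y, h⟩ : G.Star (G.vertexOf x)))).comp
          (ContinuousLinearMap.proj (R := ℂ) (G.vertexOf x)) := by
      ext M
      exact G.blockMatrix_apply_coe M (v := G.vertexOf x) ⟨x, rfl⟩ ⟨y, h⟩
    rw [h1]
    exact ContinuousLinearMap.differentiable _
  · simp only [fun M => G.blockMatrix_apply_of_ne (R := ℂ) M fun h' => h h'.symm]
    exact differentiable_const _

theorem differentiable_coeff_walkPoly (e' : E) (m : ℕ) (x : Ends I E) (d : I →₀ ℕ) :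
    Differentiable ℂ fun M : ∀ v, Matrix (G.Star v) (G.Star v) ℂ =>
      coeff d (walkPoly (G.blockMatrix M) e' m x) := by
  induction m generalizing x d with
  | zero =>
    simp only [walkPoly, coeff_C]
    split_ifs
    · exact G.differentiable_blockMatrix_apply _ _
    · exact differentiable_const _
  | succ m ih =>
    simp only [coeff_walkPoly_succ]
    refine Differentiable.fun_sum fun i _ => ?_
    split_ifs
    · exact ((G.differentiable_blockMatrix_apply _ _).mul (ih _ _)).add
        ((G.differentiable_blockMatrix_apply _ _).mul (ih _ _))
    · exact differentiable_const _

/-- The product of the normalized Haar measures on the unitary groups at the vertices. -/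
noncomputable def haarLocal : Measure (∀ v, unitaryGroup (G.Star v) ℂ) :=
  Measure.pi fun v => haarUnitary (G.Star v)

/-- An entire function of the blocks that does not vanish identically is nonzero at Haar almost all
families of unitary matrices. -/
theorem ae_haarLocal_ne_zero {f : (∀ v, Matrix (G.Star v) (G.Star v) ℂ) → ℂ}
    (hf : Differentiable ℂ f) {M : ∀ v, Matrix (G.Star v) (G.Star v) ℂ} (hM : f M ≠ 0) :
    ∀ᵐ U ∂G.haarLocal, f (fun v => (U v : Matrix (G.Star v) (G.Star v) ℂ)) ≠ 0 := by
  have hH : ∀ v, (haarUnitary (G.Star v)).IsHaarMeasure := fun v => by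
    unfold haarUnitary; infer_instance
  have hSF : ∀ v, SigmaFinite (haarUnitary (G.Star v)) := fun v => by
    unfold haarUnitary; infer_instance
  have : G.haarLocal.IsMulLeftInvariant := by unfold haarLocal; infer_instance
  have : SFinite G.haarLocal := by unfold haarLocal; infer_instance
  -- The product of the matrix algebras is one Banach algebra, whose unitary group is the product of
  -- those at the vertices.
  let ρ : (∀ v, unitaryGroup (G.Star v) ℂ) →* ∀ v, Matrix (G.Star v) (G.Star v) ℂ :=
    { toFun := fun U v => U v
      map_one' := rfl
      map_mul' := fun _ _ => rfl }
  refine ae_ne_zero_of_differentiable G.haarLocal ρ ?_ (fun u hu => ?_) hf hM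
  · exact continuous_pi fun v => continuous_subtype_val.comp (continuous_apply v)
  · refine ⟨fun v => ⟨u v, ?_⟩, rfl⟩
    exact ⟨congrFun hu.1 v, congrFun hu.2 v⟩

/-- Both `U` and its adjoint are needed, because `k₀` may have either sign while `k` is positive. -/
theorem ae_coeff_walkPoly_ne_zero {e e' : E} {l : List I}
    (hl : G.Connects (G.ext e') (G.ext e) l) :
    ∀ᵐ U ∂G.haarLocal,
      coeff (Multiset.toFinsupp (l : Multiset I)) (walkPoly (G.blockMatrix fun v =>
        (U v : Matrix (G.Star v) (G.Star v) ℂ)) e' l.length (.inl e)) ≠ 0 ∧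
      coeff (Multiset.toFinsupp (l : Multiset I)) (walkPoly (G.blockMatrix fun v =>
        star (U v : Matrix (G.Star v) (G.Star v) ℂ)) e' l.length (.inl e)) ≠ 0 := by
  set d := Multiset.toFinsupp (l : Multiset I)
  set f : (∀ v, Matrix (G.Star v) (G.Star v) ℂ) → ℂ := fun M =>
    coeff d (walkPoly (G.blockMatrix M) e' l.length (.inl e)) with hfdef
  -- The adjoint is not holomorphic in `U`. The coefficient at `star U` is the conjugate of the one
  -- at the transpose, which is linear in `U`.
  set T : (∀ v, Matrix (G.Star v) (G.Star v) ℂ) →L[ℂ] (∀ v, Matrix (G.Star v) (G.Star v) ℂ) :=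
    LinearMap.toContinuousLinearMap
      { toFun := fun M v => (M v)ᵀ
        map_add' := fun _ _ => rfl
        map_smul' := fun _ _ => rfl }
  have hf : Differentiable ℂ f := G.differentiable_coeff_walkPoly _ _ _ _
  -- The all-ones blocks need not be unitary: nonvanishing anywhere suffices for an entire function.
  have hM : f (fun v => (of fun _ _ => 1 : Matrix (G.Star v) (G.Star v) ℕ).map
      (Nat.castRingHom ℂ)) ≠ 0 := by
    simp only [hfdef]
    rw [← blockMatrix_map _ _ _ (map_zero _), walkPoly_map, coeff_map]
    have := G.coeff_walkPoly_ne_zero (e' := e') (x := .inl e) (l := l)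
      (S := G.blockMatrix fun v => (of fun _ _ => 1 : Matrix (G.Star v) (G.Star v) ℕ))
      (fun x y hxy => by
        have := G.blockMatrix_apply_coe (v := G.vertexOf x)
          (fun v => (of fun _ _ => 1 : Matrix (G.Star v) (G.Star v) ℕ)) ⟨x, rfl⟩ ⟨y, hxy.symm⟩
        simp only at this
        rw [this]
        simp) hl
    simpa using this
  have hM' : (f ∘ T) (fun v => (of fun _ _ => 1 : Matrix (G.Star v) (G.Star v) ℕ).map
      (Nat.castRingHom ℂ)) ≠ 0 := hM
  filter_upwards [G.ae_haarLocal_ne_zero hf hM,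
    G.ae_haarLocal_ne_zero (hf.comp T.differentiable) hM'] with U h1 h2
  refine ⟨h1, fun h0 => h2 ?_⟩
  have h3 : (G.blockMatrix fun v => star (U v : Matrix (G.Star v) (G.Star v) ℂ)) =
      (G.blockMatrix fun v => (U v : Matrix (G.Star v) (G.Star v) ℂ)ᵀ).map (starRingEnd ℂ) := by
    rw [blockMatrix_map _ _ _ (map_zero _)]
    rfl
  rw [h3, walkPoly_map, coeff_map, map_eq_zero] at h0
  exact h0

/-- Local boundary conditions are described by block diagonal unitary scattering matrices, which at
the reference energy are given by the unitary parameters or their inverses. -/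
theorem exists_isVertexScattering {k₀ : ℝ} (hk₀ : k₀ ≠ 0) {k : ℝ} (hk : 0 < k)
    {A B : Matrix (Ends I E) (Ends I E) ℂ} (U : ∀ v, unitaryGroup (G.Star v) ℂ)
    (hAB : bcSpace A B = G.vertexSum fun v => unitarySpace k₀ (U v)) :
    ∃ S : ∀ v, Matrix (G.Star v) (G.Star v) ℂ, G.blockMatrix S ∈ unitaryGroup (Ends I E) ℂ ∧
      IsVertexScattering A B k (G.blockMatrix S) := by
  have hκ : k / k₀ ≠ 0 := div_ne_zero hk.ne' hk₀
  choose S hS h using fun v => exists_unitary_scattering (U v).2 hκ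
  refine ⟨S, G.blockMatrix_mem_unitaryGroup hS, fun a b => ?_⟩
  rw [hAB]
  refine G.mem_vertexSum_iff (fun v a b => ?_) a b
  rw [mem_unitarySpace_iff hk₀]
  exact h v a b

omit [Fintype V] in
theorem isVertexScattering_of_eq {k₀ : ℝ} (hk₀ : k₀ ≠ 0)
    {A B : Matrix (Ends I E) (Ends I E) ℂ} (U : ∀ v, unitaryGroup (G.Star v) ℂ)
    (hAB : bcSpace A B = G.vertexSum fun v => unitarySpace k₀ (U v)) :
    IsVertexScattering A B k₀ (G.blockMatrix fun v => U v) := by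
  intro a b
  rw [hAB]
  refine G.mem_vertexSum_iff (fun v a b => ?_) a b
  rw [mem_unitarySpace_iff hk₀, div_self hk₀]
  norm_num
  rw [mulVec_smul, smul_right_injective _ (two_ne_zero' ℂ) |>.eq_iff, eq_comm]

omit [Fintype V] in
theorem isVertexScattering_neg_of_eq {k₀ : ℝ} (hk₀ : k₀ ≠ 0)
    {A B : Matrix (Ends I E) (Ends I E) ℂ} (U : ∀ v, unitaryGroup (G.Star v) ℂ)
    (hAB : bcSpace A B = G.vertexSum fun v => unitarySpace k₀ (U v)) :
    IsVertexScattering A B (-k₀) (G.blockMatrix fun v => star (U v : Matrix _ _ ℂ)) := by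
  intro a b
  rw [hAB]
  refine G.mem_vertexSum_iff (fun v a b => ?_) a b
  -- Here `κ = -1`, and the relation becomes `U b = a`.
  rw [mem_unitarySpace_iff hk₀, neg_div, div_self hk₀]
  norm_num
  rw [mulVec_smul, smul_right_injective _ (two_ne_zero' ℂ) |>.eq_iff]
  constructor
  · rintro rfl
    rw [mulVec_mulVec, mem_unitaryGroup_iff'.1 (U v).2, one_mulVec]
  · rintro rfl
    rw [mulVec_mulVec, mem_unitaryGroup_iff.1 (U v).2, one_mulVec]

end Generic

end OpenGraph

end QuantumGraph

theorem theorem4 {V I E : Type*} [Fintype V] [Fintype I] [Fintype E]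
    [DecidableEq V] [DecidableEq I] [DecidableEq E]
    (G : QuantumGraph.OpenGraph V I E) (k₀ : ℝ) (hk₀ : k₀ ≠ 0) :
    G.HaarAlmostAllLocalBC k₀ fun A B =>
      ∀ (e e' : E) (n : I → ℤ),
        (∀ k : ℝ, 0 < k → QuantumGraph.fourierCoeff A B k n e e' = 0) ↔
          G.walksWithScore e e' n = ∅ := by
  open QuantumGraph MvPolynomial in
  have hae := MeasureTheory.ae_all_iff.2 fun e : E => MeasureTheory.ae_all_iff.2 fun e' : E =>
    MeasureTheory.ae_all_iff.2 fun l : List I => MeasureTheory.ae_all_iff.2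
      fun hl : G.Connects (G.ext e') (G.ext e) l => G.ae_coeff_walkPoly_ne_zero hl
  change ∀ᵐ U ∂G.haarLocal, _
  filter_upwards [hae] with U hU A B _ hAB e e' n
  rw [Set.eq_empty_iff_forall_notMem]
  constructor
  · rintro h l ⟨hw, hn⟩
    rw [G.isWalk_iff_connects] at hw
    obtain ⟨h1, h2⟩ := hU e e' l hw
    set d := Multiset.toFinsupp (l : Multiset I)
    have hdn : n = fun i => (d i : ℤ) := by
      ext i
      rw [← hn i, Multiset.toFinsupp_apply, Multiset.coe_count]
    have hdeg : d.degree = l.length := by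
      rw [Finsupp.degree_eq_sum]
      exact Multiset.sum_count_eq_card (s := Finset.univ) (m := (l : Multiset I))
        fun a _ => Finset.mem_univ a
    subst hdn
    -- Test the vanishing at the positive one of `k₀` and `-k₀`.
    rcases lt_or_gt_of_ne hk₀ with hneg | hpos
    · have hmem := G.blockMatrix_mem_unitaryGroup
        (M := fun v => star (U v : Matrix (G.Star v) (G.Star v) ℂ)) fun v => (star (U v)).2
      have heq := fourierCoeff_eq_coeff (neg_pos.2 hneg) hmem
        (G.isVertexScattering_neg_of_eq hk₀ U hAB) d e e'
      rw [hdeg] at heq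
      exact h2 (heq.symm.trans (h _ (neg_pos.2 hneg)))
    · have hmem := G.blockMatrix_mem_unitaryGroup
        (M := fun v => (U v : Matrix (G.Star v) (G.Star v) ℂ)) fun v => (U v).2
      have heq := fourierCoeff_eq_coeff hpos hmem
        (G.isVertexScattering_of_eq hk₀ U hAB) d e e'
      rw [hdeg] at heq
      exact h1 (heq.symm.trans (h _ hpos))
  -- This direction holds for every `U`: locality alone forces zero coefficients.
  · intro h k hk
    obtain ⟨S, hS, hSv⟩ := G.exists_isVertexScattering hk₀ hk U hAB
    by_cases hn : ∀ i, 0 ≤ n i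
    · obtain ⟨d, rfl⟩ : ∃ d : I →₀ ℕ, n = fun i => (d i : ℤ) :=
        ⟨Finsupp.equivFunOnFinite.symm fun i => (n i).toNat, by ext i; simp [hn i]⟩
      rw [fourierCoeff_eq_coeff hk hS hSv]
      by_contra hne
      obtain ⟨l, hl, hc⟩ := G.exists_connects_of_coeff_ne_zero
        (fun x y hxy => G.blockMatrix_apply_of_ne S hxy) hne
      exact h l ⟨(G.isWalk_iff_connects _ _ _).2 hl, fun i => by rw [hc]⟩
    · push Not at hn
      obtain ⟨i, hi⟩ := hn
      exact fourierCoeff_eq_zero_of_neg hk hS hSv hi e e'
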